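/- Let $\Gamma$ be a countable discrete sofic group acting by homeomorphisms on a compact metrizable space $X$, and let $\Sigma=(\sigma_i\colon\Gamma\to S_{d_i})_{i\in\mathbb N}$ be a sofic approximation of $\Gamma$: $d_i\to\infty$, and for the uniform probability measure $\mathbb P$ on $\{1,\dots,d_i\}$ one has $\mathbb P(\{k:\sigma_i(g)\sigma_i(h)(k)=\sigma_i(gh)(k)\})\to1$ for all $g,h\in\Gamma$ and $\mathbb P(\{k:\sigma_i(g)(k)\neq\sigma_i(h)(k)\})\to 1$ for all $g\ne h$ in $\Gamma$. Notation. For a pseudometric $\rho$ on $X$, let $\rho_p(x,y)=\big(\frac1k\sum_{j=1}^k\rho(x_j,y_j)^p\big)^{1/p}$ for $1\le p<\infty$ and $\rho_\infty(x,y)=\max_j\rho(x_j,y_j)$ on $X^k$. A pseudometric $\rho$ on $X$ is dynamically generating if for all $x\ne y$ there is $g\in\Gamma$ with $\rho(gx,gy)>0$. For $F\subseteq\Gamma$ finite and $\delta>0$, let $\mathrm{Map}(\rho,F,\delta,\sigma_i)$ be the set of all $\phi\colon\{1,\dots,d_i\}\to X$ with $\rho_2(\phi\circ\sigma_i(g),g\phi)<\delta$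 for all $g\in F$. For a set $A$ with a pseudometric $d$, let $S_\varepsilon(A,d)$ be the smallest cardinality of a subset $B\subseteq A$ such that every $a\in A$ satisfies $d(a,b)<\varepsilon$ for some $b\in B$. If $A$ is moreover a topological space, let $\mathrm{wdim}_\varepsilon(A,d)$ be the smallest (Lebesgue) covering dimension of a compact metrizable space $K$ for which there is a continuous map $f\colon A\to K$ such that $f(x)=f(y)$ implies $d(x,y)<\varepsilon$. All quantities are extended real numbers, with $\log 0=-\infty$ and $\dim\emptyset=-\infty$. Define $$\mathrm{mdim}_\Sigma(X,\Gamma)=\sup_{\varepsilon>0}\ \inf_{F\subseteq\Gamma\text{ finite},\ \delta>0}\ \limsup_{i\to\infty}\frac{\mathrm{wdim}_\varepsilon(\mathrm{Map}(\rho,F,\delta,\sigma_i),\rho'_\infty)}{d_i},$$ where $\rho$ is any dynamically generating continuous pseudometric on $X$, $\rho'$ is any compatible metric on $X$, and $\mathrm{Map}(\rho,F,\delta,\sigma_i)$ carries the topology induced from $X^{d_i}$ (the value does not depend on the choice of $\rho,\rho'$; the statement is asserted for every choice). For $1\le p\le\infty$ define $$\mathrm{mdim}_{\Sigma,M,p}(X,\Gamma)=\inf_\rho\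 \liminf_{\varepsilon\to0^+}\ \inf_{F\subseteq\Gamma\text{ finite},\ \delta>0}\ \limsup_{i\to\infty}\frac{\log S_\varepsilon(\mathrm{Map}(\rho,F,\delta,\sigma_i),\rho_p)}{d_i\log(1/\varepsilon)},$$ where $\rho$ ranges over all dynamically generating continuous pseudometrics on $X$. Then for all $1\le p\le q\le\infty$, $$\mathrm{mdim}_\Sigma(X,\Gamma)\le\mathrm{mdim}_{\Sigma,M,p}(X,\Gamma)\le\mathrm{mdim}_{\Sigma,M,q}(X,\Gamma).$$ -/

import Mathlib

open Filter Topology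
open scoped ENNReal

noncomputable section

namespace SoficMeanDim

/-- A sofic approximation of `Γ`: maps `σ i : Γ → Sym(d i)` with `d i → ∞` that are asymptotically
multiplicative and asymptotically free, with respect to the uniform probability measure on
`{1, …, d i}`. -/
structure SoficApproximation (Γ : Type*) [Group Γ] where
  d : ℕ → ℕ
  σ : (i : ℕ) → Γ → Equiv.Perm (Fin (d i))
  tendsto_d : Tendsto d atTop atTop
  asymp_mul : ∀ g h : Γ,
    Tendsto (fun i => ((Finset.univ.filter
      (fun k : Fin (d i) => σ i g (σ i h k) = σ i (g * h) k)).card : ℝ) / (d i : ℝ)) atTop (𝓝 1)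
  asymp_free : ∀ g h : Γ, g ≠ h →
    Tendsto (fun i => ((Finset.univ.filter
      (fun k : Fin (d i) => σ i g k ≠ σ i h k)).card : ℝ) / (d i : ℝ)) atTop (𝓝 1)

/-! ### Pseudometrics -/

/-- A pseudometric is continuous if it is (jointly) continuous on `X × X`. -/
def IsContinuousPseudometric {X : Type*} [TopologicalSpace X] (ρ : PseudoMetric X ℝ) : Prop :=
  Continuous (fun z : X × X => ρ z.1 z.2)

/-- `ρ` is a metric that induces the topology of `X`. -/
def IsCompatibleMetric {X : Type*} [TopologicalSpace X] (ρ : PseudoMetric X ℝ) : Prop :=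
  (∀ x y, ρ x y = 0 → x = y) ∧
  ∀ s : Set X, IsOpen s ↔ ∀ x ∈ s, ∃ ε : ℝ, 0 < ε ∧ ∀ y, ρ x y < ε → y ∈ s

/-- `ρ` is dynamically generating: distinct points are separated by a translate of `ρ`. -/
def IsDynamicallyGenerating (Γ : Type*) {X : Type*} [Group Γ] [MulAction Γ X]
    (ρ : PseudoMetric X ℝ) : Prop :=
  ∀ x y : X, x ≠ y → ∃ g : Γ, 0 < ρ (g • x) (g • y)

/-- The normalized `ℓ^p`-product `ρ_p` of `ρ` on `X^k`, for `p ∈ [1, ∞]`. -/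
def lpDist {X : Type*} (ρ : PseudoMetric X ℝ) (p : ℝ≥0∞) {k : ℕ} (x y : Fin k → X) : ℝ :=
  if p = ∞ then ⨆ j, ρ (x j) (y j)
  else ((1 / (k : ℝ)) * ∑ j, ρ (x j) (y j) ^ p.toReal) ^ (1 / p.toReal)

/-- `S_ε(A, d)`: the smallest cardinality of a subset `B` of `A` such that every point of `A` is
at distance less than `ε` from a point of `B`. -/
def denseCard {Y : Type*} (ε : ℝ) (A : Set Y) (d : Y → Y → ℝ) : ℕ∞ :=
  sInf {n | ∃ B : Set Y, B ⊆ A ∧ (∀ a ∈ A, ∃ b ∈ B, d a b < ε) ∧ n = B.encard}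

/-! ### Covering dimension and widths

Dimensions are extended reals: the empty space has dimension `-∞`, and every non-empty space
has dimension in `{0, 1, 2, …, +∞}`. -/

/-- `𝒰` is a cover of `Y` by open sets. -/
def IsOpenCover {Y : Type*} [TopologicalSpace Y] (𝒰 : Set (Set Y)) : Prop :=
  (∀ U ∈ 𝒰, IsOpen U) ∧ ⋃₀ 𝒰 = Set.univ

/-- `𝒱` refines `𝒰`. -/
def Refines {Y : Type*} (𝒱 𝒰 : Set (Set Y)) : Prop :=
  ∀ V ∈ 𝒱, ∃ U ∈ 𝒰, V ⊆ U

/-- The order of a cover: `sup_x (-1 + ∑_{U ∈ 𝒰} χ_U(x))`. -/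
def coverOrd {Y : Type*} (𝒰 : Set (Set Y)) : EReal :=
  ⨆ x : Y, ((({U ∈ 𝒰 | x ∈ U}.encard : ℝ≥0∞) : EReal) - 1)

/-- The least order of an open cover that refines `𝒰`. -/
def refinedOrd {Y : Type*} [TopologicalSpace Y] (𝒰 : Set (Set Y)) : EReal :=
  sInf {n | ∃ 𝒱 : Set (Set Y), IsOpenCover 𝒱 ∧ Refines 𝒱 𝒰 ∧ n = coverOrd 𝒱}

/-- The (Lebesgue) covering dimension. -/
def coveringDim (Y : Type*) [TopologicalSpace Y] : EReal :=
  sSup {n | ∃ 𝒰 : Set (Set Y), IsOpenCover 𝒰 ∧ n = refinedOrd 𝒰}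

/-- `wdim_ε(Y, d)`: the smallest dimension of a compact metrizable space `K` that receives a
continuous map `f` from `Y` with `d x y < ε` whenever `f x = f y`. Every compact metrizable space
is homeomorphic to a subset of the Hilbert cube, so `K : Type` is no restriction. -/
def wdim (Y : Type*) [TopologicalSpace Y] (d : Y → Y → ℝ) (ε : ℝ) : EReal :=
  sInf {n | ∃ (K : Type) (_ : TopologicalSpace K), CompactSpace K ∧
    TopologicalSpace.MetrizableSpace K ∧
    (∃ f : Y → K, Continuous f ∧ ∀ x y, f x = f y → d x y < ε) ∧ n = coveringDim K}

section Dynamics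

variable {Γ X : Type*} [Group Γ] [MulAction Γ X]

/-- `Map(ρ, F, δ, σ)`: the `φ : {1, …, n} → X` with `ρ_2(φ ∘ σ(g), g φ) < δ` for all `g ∈ F`. -/
def microstates (ρ : PseudoMetric X ℝ) (F : Finset Γ) (δ : ℝ) {n : ℕ}
    (σ : Γ → Equiv.Perm (Fin n)) : Set (Fin n → X) :=
  {φ | ∀ g ∈ F, lpDist ρ 2 (fun j => φ (σ g j)) (fun j => g • φ j) < δ}

/-- The sofic mean dimension `mdim_Σ(X, Γ)`, computed from the dynamically generating continuous
pseudometric `ρ` and the compatible metric `ρ'`. -/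
def mdim [TopologicalSpace X] (S : SoficApproximation Γ) (ρ ρ' : PseudoMetric X ℝ) : EReal :=
  ⨆ (ε : ℝ) (_ : 0 < ε), ⨅ (F : Finset Γ) (δ : ℝ) (_ : 0 < δ),
    limsup (fun i => wdim (microstates ρ F δ (S.σ i))
      (fun φ ψ => lpDist ρ' ∞ φ.1 ψ.1) ε / ((S.d i : ℝ) : EReal)) atTop

/-- `mdim_{Σ,p}(F, δ, ε, ρ)`. -/
def metricMdimAt (S : SoficApproximation Γ) (p : ℝ≥0∞) (F : Finset Γ) (δ ε : ℝ)
    (ρ : PseudoMetric X ℝ) : EReal :=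
  limsup (fun i => ENNReal.log (denseCard ε (microstates ρ F δ (S.σ i)) (lpDist ρ p) : ℝ≥0∞) /
    (((S.d i : ℝ) * Real.log (1 / ε) : ℝ) : EReal)) atTop

/-- `mdim_{Σ,p}(X, ρ)`. -/
def metricMdimOf (S : SoficApproximation Γ) (p : ℝ≥0∞) (ρ : PseudoMetric X ℝ) : EReal :=
  liminf (fun ε : ℝ => ⨅ (F : Finset Γ) (δ : ℝ) (_ : 0 < δ), metricMdimAt S p F δ ε ρ) (𝓝[>] 0)

variable (X) in
/-- The sofic `p`-metric mean dimension `mdim_{Σ,M,p}(X, Γ)`. -/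
def metricMdim [TopologicalSpace X] (S : SoficApproximation Γ) (p : ℝ≥0∞) : EReal :=
  ⨅ (ρ : PseudoMetric X ℝ) (_ : IsContinuousPseudometric ρ) (_ : IsDynamicallyGenerating Γ ρ),
    metricMdimOf S p ρ

end Dynamics

end SoficMeanDim

end

open Filter Topology
open scoped ENNReal

/-! Monotonicity in the exponent is the power mean inequality, so only `p = 1` has to be compared
with mean dimension. Fix `ε`. Compactness gives finitely many bump functions `f a`, Lipschitz for a
finite orbit sum of `ρ`, whose values on `φ` determine `φ` up to `ε` in the sup distance. Together
they map microstates to a space with `d * n` coordinates.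

Suppose about `η ^ (-c * d)` points form an `η`-net for the mean distance. Enlarge the coordinates
by `M ≈ κ / η`, subtract integers `ξ e` and clamp to `[0, 1]`. Union bound: some `ξ` leaves, for
every net point at once, at most `k ≈ c * d` coordinates near the unclamped window
(`exists_avoiding`). A microstate close to a net point differs from it by 1 or more, after
enlargement, in only a small proportion of coordinates, by Markov's inequality. So the image lies in
a skeleton of a cube of dimension about `c * d`, and such a skeleton has covering dimension at most
that number (`coveringDim_cubeSkeleton_le`). The clamped map still separates, since `f a = 1` goes
to 1 and `f a ≤ 0` goes to 0 (`wdim_le_of_separating`). -/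

namespace SoficMeanDim

/-! ### Covering dimension of skeleta of cubes -/

/-- The points of the cube `[0, 1]^ι` with at most `k` coordinates outside `{0, 1}`. -/
def cubeSkeleton (ι : Type) (k : ℕ) : Set (ι → ℝ) :=
  {z | (∀ j, z j ∈ Set.Icc (0 : ℝ) 1) ∧
    ∃ T : Finset ι, T.card ≤ k ∧ ∀ j, j ∉ T → z j = 0 ∨ z j = 1}

lemma isCompact_cubeSkeleton (ι : Type) [Fintype ι] (k : ℕ) : IsCompact (cubeSkeleton ι k) := by
  have hcube : IsCompact (Set.univ.pi fun _ : ι => Set.Icc (0 : ℝ) 1) :=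
    isCompact_univ_pi fun _ => isCompact_Icc
  have hclosed : IsClosed (⋃ T ∈ {T : Finset ι | T.card ≤ k},
      ⋂ j ∈ {j : ι | j ∉ T}, {z : ι → ℝ | z j = 0 ∨ z j = 1}) := by
    refine Set.Finite.isClosed_biUnion (Set.toFinite _) fun T _ => ?_
    refine isClosed_biInter fun j _ => ?_
    exact (isClosed_eq (continuous_apply j) continuous_const).union
      (isClosed_eq (continuous_apply j) continuous_const)
  convert hcube.inter_right hclosed using 1
  ext z
  simp [cubeSkeleton, -Set.pi_univ_Icc]

/-- The open cell of the grid `ℤ^ι / m`, spanned by the directions in `T` at the vertex `g`,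
thickened by `1 / (m (#T + 3))` in the other directions and shrunk by as much along itself. -/
def gridCell {ι : Type} (m : ℕ) (T : Finset ι) (g : ι → ℤ) : Set (ι → ℝ) :=
  {z | (∀ j ∈ T, g j + 1 / ((T.card : ℝ) + 3) < m * z j ∧
      m * z j < g j + 1 - 1 / ((T.card : ℝ) + 3)) ∧
    ∀ j, j ∉ T → |m * z j - g j| < 1 / ((T.card : ℝ) + 3)}

lemma isOpen_gridCell {ι : Type} [Fintype ι] (m : ℕ) (T : Finset ι) (g : ι → ℤ) :
    IsOpen (gridCell m T g) := by
  have h : gridCell m T g = (⋂ j ∈ {j : ι | j ∈ T},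
      ({z : ι → ℝ | g j + 1 / ((T.card : ℝ) + 3) < m * z j} ∩
        {z : ι → ℝ | m * z j < g j + 1 - 1 / ((T.card : ℝ) + 3)})) ∩
      ⋂ j ∈ {j : ι | j ∉ T}, {z : ι → ℝ | |m * z j - g j| < 1 / ((T.card : ℝ) + 3)} := by
    ext z
    simp [gridCell]
  rw [h]
  refine IsOpen.inter (Set.Finite.isOpen_biInter (Set.toFinite _) fun j _ => ?_)
    (Set.Finite.isOpen_biInter (Set.toFinite _) fun j _ => ?_)
  · exact (isOpen_lt (by fun_prop) (by fun_prop)).inter (isOpen_lt (by fun_prop) (by fun_prop))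
  · exact isOpen_lt (by fun_prop) (by fun_prop)

/-- Equal cardinality means equal thickness. In a direction of `T`, `m * z j` stays farther from the
integers than this thickness; in a direction outside `T'` it is closer to one. Hence a point lies in
at most one cell of each dimension, which bounds the order of the cover. -/
lemma gridCell_unique {ι : Type} {m : ℕ} {T T' : Finset ι} {g g' : ι → ℤ} {z : ι → ℝ}
    (h : z ∈ gridCell m T g) (h' : z ∈ gridCell m T' g') (hT : T.card = T'.card) :
    T = T' ∧ g = g' := by
  obtain ⟨h1, h2⟩ := h
  obtain ⟨h1', h2'⟩ := h'
  rw [← hT] at h1' h2'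
  have ha0 : 0 < 1 / ((T.card : ℝ) + 3) := by positivity
  have ha1 : 1 / ((T.card : ℝ) + 3) ≤ 1 / 3 :=
    one_div_le_one_div_of_le (by norm_num) (by linarith [(Nat.cast_nonneg T.card : (0 : ℝ) ≤ _)])
  generalize 1 / ((T.card : ℝ) + 3) = a at *
  have hTT : T = T' := by
    refine Finset.eq_of_subset_of_card_le (fun j hj => ?_) hT.ge
    by_contra hj'
    obtain ⟨h3, h4⟩ := h1 j hj
    obtain ⟨h5, h6⟩ := abs_lt.1 (h2' j hj')
    have h7 : (g j : ℝ) < g' j := by linarith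
    have h8 : (g' j : ℝ) < g j + 1 := by linarith
    norm_cast at h7 h8
    omega
  subst hTT
  refine ⟨rfl, funext fun j => ?_⟩
  have h7 : (g j : ℝ) < g' j + 1 ∧ (g' j : ℝ) < g j + 1 := by
    by_cases hj : j ∈ T
    · have := h1 j hj
      have := h1' j hj
      constructor <;> linarith
    · have := abs_lt.1 (h2 j hj)
      have := abs_lt.1 (h2' j hj)
      constructor <;> linarith
  obtain ⟨h7, h8⟩ := h7
  norm_cast at h7 h8
  omega

lemma exists_mem_gridCell {ι : Type} [Fintype ι] (m : ℕ) {k : ℕ} {z : ι → ℝ}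
    (hz : z ∈ cubeSkeleton ι k) :
    ∃ (T : Finset ι) (g : ι → ℤ), T.card ≤ k ∧ z ∈ gridCell m T g := by
  classical
  obtain ⟨-, T₀, hT₀, hz0⟩ := hz
  set t : ι → ℝ := fun j => |m * z j - round (m * z j)| with ht
  have hk : (Finset.univ.filter fun j => 1 / ((k : ℝ) + 3) ≤ t j).card ≤ k := by
    refine (Finset.card_le_card fun j hj => ?_).trans hT₀
    by_contra hjT
    have h0 : t j = 0 := by
      rcases hz0 j hjT with h | h <;> simp [ht, h]
    have : (0 : ℝ) < 1 / ((k : ℝ) + 3) := by positivity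
    rw [Finset.mem_filter, h0] at hj
    linarith [hj.2]
  -- The least such `r` is the dimension of the cell. Since `r - 1` fails, at least `r` coordinates
  -- satisfy `t j ≥ 1 / (r + 2) > 1 / (r + 3)`; so exactly `r` exceed the threshold and none equals
  -- it, as the strict inequalities of the cell require.
  have hex : ∃ r : ℕ, (Finset.univ.filter fun j => 1 / ((r : ℝ) + 3) ≤ t j).card ≤ r := ⟨k, hk⟩
  set r := Nat.find hex with hr
  have hr1 : (Finset.univ.filter fun j => 1 / ((r : ℝ) + 3) ≤ t j).card ≤ r := Nat.find_spec hex
  have hrk : r ≤ k := Nat.find_min' hex hk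
  set T := Finset.univ.filter fun j => 1 / ((r : ℝ) + 3) < t j with hT
  have hsub : T ⊆ Finset.univ.filter fun j => 1 / ((r : ℝ) + 3) ≤ t j := fun j hj => by
    simp only [hT, Finset.mem_filter] at hj ⊢
    exact ⟨hj.1, hj.2.le⟩
  have hrT : r ≤ T.card := by
    rcases Nat.eq_zero_or_pos r with h0 | h0
    · omega
    · have h1 := Nat.find_min hex (m := r - 1) (by omega)
      have h2 : (Finset.univ.filter fun j => 1 / (((r - 1 : ℕ) : ℝ) + 3) ≤ t j) ⊆ T := by
        intro j hj
        simp only [hT, Finset.mem_filter] at hj ⊢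
        refine ⟨hj.1, lt_of_lt_of_le ?_ hj.2⟩
        apply one_div_lt_one_div_of_lt (by positivity)
        have : r - 1 < r := by omega
        have : ((r - 1 : ℕ) : ℝ) < r := by exact_mod_cast this
        linarith
      have h3 := Finset.card_le_card h2
      omega
  have hTr : T.card = r := le_antisymm ((Finset.card_le_card hsub).trans hr1) hrT
  have heq := Finset.eq_of_subset_of_card_le hsub (hr1.trans hrT)
  refine ⟨T, fun j => if j ∈ T then ⌊m * z j⌋ else round (m * z j), hTr.trans_le hrk, ?_, ?_⟩
  · intro j hj
    simp only [hTr, if_pos hj]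
    have hj' : 1 / ((r : ℝ) + 3) < t j := (Finset.mem_filter.1 hj).2
    have h1 := hj'.trans_le (round_le (m * z j) ⌊m * z j⌋)
    have h2 := hj'.trans_le (round_le (m * z j) (⌊m * z j⌋ + 1))
    have h3 := Int.floor_le (m * z j)
    have h4 := Int.lt_floor_add_one (m * z j)
    rw [abs_of_nonneg (by linarith)] at h1
    push_cast at h2
    rw [abs_of_nonpos (by linarith)] at h2
    constructor <;> linarith
  · intro j hj
    simp only [hTr, if_neg hj]
    by_contra h
    apply hj
    rw [heq]
    exact Finset.mem_filter.2 ⟨Finset.mem_univ _, not_lt.1 h⟩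

lemma dist_lt_of_mem_gridCell {ι : Type} [Fintype ι] {m : ℕ} {T : Finset ι} {g : ι → ℤ}
    {z w : ι → ℝ} {r : ℝ} (hr : 0 < r) (hm : 1 < m * r)
    (hz : z ∈ gridCell m T g) (hw : w ∈ gridCell m T g) : dist z w < r := by
  have hm0 : (0 : ℝ) < m := by
    by_contra h
    have : (m : ℝ) * r ≤ 0 := mul_nonpos_of_nonpos_of_nonneg (not_lt.1 h) hr.le
    linarith
  have ha0 : 0 < 1 / ((T.card : ℝ) + 3) := by positivity
  have ha1 : 1 / ((T.card : ℝ) + 3) ≤ 1 / 3 :=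
    one_div_le_one_div_of_le (by norm_num) (by linarith [(Nat.cast_nonneg T.card : (0 : ℝ) ≤ _)])
  refine (dist_pi_lt_iff hr).2 fun j => ?_
  have key : |m * (z j - w j)| < m * r := by
    refine lt_of_lt_of_le ?_ hm.le
    rw [mul_sub, abs_lt]
    by_cases hj : j ∈ T
    · have := hz.1 j hj
      have := hw.1 j hj
      constructor <;> linarith
    · have := abs_lt.1 (hz.2 j hj)
      have := abs_lt.1 (hw.2 j hj)
      constructor <;> linarith
  rw [abs_mul, abs_of_pos hm0] at key
  rw [Real.dist_eq]
  exact lt_of_mul_lt_mul_left key hm0.le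

/-- Grid cells finer than a Lebesgue number refine any open cover, and each point meets at most one
cell of each of the dimensions `0, …, k`. -/
lemma coveringDim_cubeSkeleton_le (ι : Type) [Fintype ι] (k : ℕ) :
    coveringDim (cubeSkeleton ι k) ≤ ((k : ℝ) : EReal) := by
  have : CompactSpace (cubeSkeleton ι k) :=
    isCompact_iff_compactSpace.1 (isCompact_cubeSkeleton ι k)
  refine sSup_le ?_
  rintro _ ⟨𝒰, ⟨hUo, hUc⟩, rfl⟩
  obtain ⟨r, hr, hball⟩ := lebesgue_number_lemma_of_metric_sUnion
    (isCompact_univ (X := cubeSkeleton ι k)) hUo hUc.ge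
  obtain ⟨m, hm⟩ := exists_nat_gt (1 / r)
  rw [div_lt_iff₀ hr] at hm
  set cell : Finset ι × (ι → ℤ) → Set (cubeSkeleton ι k) :=
    fun e => Subtype.val ⁻¹' gridCell m e.1 e.2 with hcell
  refine sInf_le_of_le ⟨{V | V.Nonempty ∧ ∃ e : Finset ι × (ι → ℤ), e.1.card ≤ k ∧ V = cell e},
    ⟨?_, ?_⟩, ?_, rfl⟩ ?_
  · rintro V ⟨-, e, -, rfl⟩
    exact (isOpen_gridCell m e.1 e.2).preimage continuous_subtype_val
  · refine Set.eq_univ_of_forall fun z => ?_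
    obtain ⟨T, g, hT, hz⟩ := exists_mem_gridCell m z.2
    exact ⟨cell (T, g), ⟨⟨z, hz⟩, (T, g), hT, rfl⟩, hz⟩
  · rintro V ⟨⟨z, hz⟩, e, -, rfl⟩
    obtain ⟨U, hU, hzU⟩ := hball z (Set.mem_univ _)
    exact ⟨U, hU, fun w hw => hzU (dist_lt_of_mem_gridCell hr hm hw hz)⟩
  · refine iSup_le fun z => ?_
    have hcard : {V ∈ {V | V.Nonempty ∧ ∃ e : Finset ι × (ι → ℤ), e.1.card ≤ k ∧ V = cell e} |
        z ∈ V}.encard ≤ ((k + 1 : ℕ) : ℕ∞) := by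
      classical
      choose! G hG using fun (r : ℕ) (h : ∃ e : Finset ι × (ι → ℤ),
        e.1.card = r ∧ z ∈ cell e) => h
      refine (Set.encard_le_encard (t := ((Finset.range (k + 1)).image fun r => cell (G r) :
        Finset (Set (cubeSkeleton ι k)))) ?_).trans ?_
      · rintro V ⟨⟨-, e, he, rfl⟩, hz⟩
        obtain ⟨h1, h2⟩ := hG e.1.card ⟨e, rfl, hz⟩
        obtain ⟨h3, h4⟩ := gridCell_unique h2 hz h1
        simp only [Finset.coe_image, Set.mem_image, Finset.coe_range, Set.mem_Iio]
        exact ⟨e.1.card, by omega, by rw [Prod.ext h3 h4]⟩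
      · rw [Set.encard_coe_eq_coe_finsetCard]
        exact_mod_cast Finset.card_image_le.trans (Finset.card_range _).le
    have h2 : ((ENat.toENNReal {V ∈ {V | V.Nonempty ∧ ∃ e : Finset ι × (ι → ℤ),
        e.1.card ≤ k ∧ V = cell e} | z ∈ V}.encard : ℝ≥0∞) : EReal) ≤ (((k : ℝ) + 1 : ℝ) : EReal) := by
      have h3 := ENat.toENNReal_le.2 hcard
      have h4 : ((ENat.toENNReal ((k + 1 : ℕ) : ℕ∞) : ℝ≥0∞) : EReal) = (((k : ℝ) + 1 : ℝ) : EReal) := by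
        rw [ENat.toENNReal_coe, ← ENNReal.coe_natCast, EReal.coe_nnreal_eq_coe_real]
        simp
      rw [← h4]
      exact EReal.coe_ennreal_le_coe_ennreal_iff.2 h3
    refine (EReal.sub_le_sub h2 le_rfl).trans ?_
    rw [← EReal.coe_one, ← EReal.coe_sub]
    simp

/-! ### A counting argument -/

/-- Union bound: for fixed `b` and a fixed `k`-set `T`, the proportion of `ξ` that are bad
throughout `T` is at most `(3 / M) ^ k`. There are at most `2 ^ N` sets `T`, with `N` the number of
coordinates, and `3 ^ k ≤ 3 ^ N`, whence the factor `6 ^ N`. -/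
lemma exists_avoiding {ι β : Type*} [Fintype ι] {M k : ℕ} (hM : 0 < M) (B : Finset β)
    (bad : β → ι → Finset (Fin M)) (hbad : ∀ b j, (bad b j).card ≤ 3)
    (hB : B.card * 6 ^ Fintype.card ι < M ^ k) :
    ∃ ξ : ι → Fin M, ∀ b ∈ B, ∃ T : Finset ι, T.card ≤ k ∧ ∀ j, j ∉ T → ξ j ∉ bad b j := by
  classical
  by_contra! hcon
  have hcover : (Finset.univ : Finset (ι → Fin M)) ⊆ B.biUnion fun b =>
      (Finset.univ.powersetCard k).biUnion fun T =>
        Fintype.piFinset fun j => if j ∈ T then bad b j else Finset.univ := by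
    intro ξ _
    obtain ⟨b, hb, h⟩ := hcon ξ
    have hk : k ≤ (Finset.univ.filter fun j => ξ j ∈ bad b j).card := by
      by_contra hlt
      obtain ⟨j, hj, hj'⟩ := h _ (not_le.1 hlt).le
      exact hj (Finset.mem_filter.2 ⟨Finset.mem_univ _, hj'⟩)
    obtain ⟨T, hT, hTk⟩ := Finset.exists_subset_card_eq hk
    simp only [Finset.mem_biUnion, Finset.mem_powersetCard, Fintype.mem_piFinset]
    refine ⟨b, hb, T, ⟨Finset.subset_univ _, hTk⟩, fun j => ?_⟩
    split_ifs with hj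
    · exact (Finset.mem_filter.1 (hT hj)).2
    · exact Finset.mem_univ _
  -- Multiplying by `M ^ k` avoids division: each coordinate then contributes at most `3 * M`.
  have hone : ∀ b, ∀ T ∈ (Finset.univ : Finset ι).powersetCard k,
      (Fintype.piFinset fun j => if j ∈ T then bad b j else Finset.univ).card * M ^ k ≤
        3 ^ Fintype.card ι * M ^ Fintype.card ι := by
    intro b T hT
    rw [Finset.mem_powersetCard] at hT
    rw [Fintype.card_piFinset, ← hT.2]
    have h1 : (∏ j, (if j ∈ T then bad b j else Finset.univ).card) ≤
        ∏ j, (if j ∈ T then 3 else M) := by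
      refine Finset.prod_le_prod' fun j _ => ?_
      split_ifs
      · exact hbad b j
      · simp
    have h2 : M ^ T.card = ∏ j, (if j ∈ T then M else 1) := by
      rw [Finset.prod_ite_mem, Finset.univ_inter, Finset.prod_const]
    calc _ ≤ (∏ j, (if j ∈ T then 3 else M)) * ∏ j, (if j ∈ T then M else 1) := by
          rw [h2]; exact Nat.mul_le_mul_right _ h1
      _ = ∏ j : ι, (if j ∈ T then 3 else M) * (if j ∈ T then M else 1) := by
          rw [Finset.prod_mul_distrib]
      _ ≤ ∏ _j : ι, 3 * M := by
          refine Finset.prod_le_prod' fun j _ => ?_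
          split_ifs <;> omega
      _ = _ := by simp [Finset.prod_const, mul_pow]
  have h1 : M ^ Fintype.card ι * M ^ k ≤
      (B.card * 6 ^ Fintype.card ι) * M ^ Fintype.card ι := by
    calc M ^ Fintype.card ι * M ^ k = (Finset.univ : Finset (ι → Fin M)).card * M ^ k := by simp
      _ ≤ (∑ b ∈ B, ∑ T ∈ (Finset.univ : Finset ι).powersetCard k,
          (Fintype.piFinset fun j => if j ∈ T then bad b j else Finset.univ).card) * M ^ k := by
          refine Nat.mul_le_mul_right _ ((Finset.card_le_card hcover).trans ?_)
          refine Finset.card_biUnion_le.trans (Finset.sum_le_sum fun b _ => ?_)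
          exact Finset.card_biUnion_le
      _ = ∑ b ∈ B, ∑ T ∈ (Finset.univ : Finset ι).powersetCard k,
          (Fintype.piFinset fun j => if j ∈ T then bad b j else Finset.univ).card * M ^ k := by
          simp only [Finset.sum_mul]
      _ ≤ ∑ _b ∈ B, ∑ _T ∈ (Finset.univ : Finset ι).powersetCard k,
          3 ^ Fintype.card ι * M ^ Fintype.card ι :=
          Finset.sum_le_sum fun b _ => Finset.sum_le_sum fun T hT => hone b T hT
      _ = B.card * ((Fintype.card ι).choose k * (3 ^ Fintype.card ι * M ^ Fintype.card ι)) := by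
          simp [Finset.card_powersetCard]
      _ ≤ B.card * (2 ^ Fintype.card ι * (3 ^ Fintype.card ι * M ^ Fintype.card ι)) := by
          gcongr
          exact Nat.choose_le_two_pow _ _
      _ = _ := by
          rw [show 6 = 2 * 3 from rfl, mul_pow]; ring
  have h2 : M ^ k ≤ B.card * 6 ^ Fintype.card ι := by
    rw [mul_comm] at h1
    exact Nat.le_of_mul_le_mul_right h1 (pow_pos hM _)
  omega

/-! ### Normalized `ℓ^p`-distances -/

section LpDist

variable {X : Type*} (ρ : PseudoMetric X ℝ)

lemma lpDist_le_lpDist {p q : ℝ≥0∞} (hp : 1 ≤ p) (hpq : p ≤ q) {k : ℕ} (x y : Fin k → X) :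
    lpDist ρ p x y ≤ lpDist ρ q x y := by
  rcases eq_or_ne p ∞ with rfl | hp'
  · rw [top_le_iff.1 hpq]
  have ha : 1 ≤ p.toReal := by
    simpa using ENNReal.toReal_mono hp' hp
  have ha0 : 0 < p.toReal := by linarith
  -- For `k = 0` the weights `1 / k` are 0 and do not sum to 1, so Jensen's inequality is
  -- unavailable.
  rcases Nat.eq_zero_or_pos k with rfl | hk
  · have h0 : lpDist ρ p x y = 0 := by
      simp [lpDist, hp', Real.zero_rpow (inv_pos.2 ha0).ne']
    rw [h0, lpDist]
    split_ifs
    · simp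
    · positivity
  have hk' : (0 : ℝ) < k := by exact_mod_cast hk
  have hw : ∑ _j : Fin k, 1 / (k : ℝ) = 1 := by
    simp [hk'.ne']
  have hnn : ∀ j, 0 ≤ ρ (x j) (y j) := fun j => ρ.nonneg _ _
  have hsum : 0 ≤ ∑ j, 1 / (k : ℝ) * ρ (x j) (y j) ^ p.toReal :=
    Finset.sum_nonneg fun j _ => mul_nonneg (by positivity) (Real.rpow_nonneg (hnn j) _)
  rcases eq_or_ne q ∞ with rfl | hq'
  · have : Nonempty (Fin k) := ⟨⟨0, hk⟩⟩
    rw [lpDist, lpDist, if_neg hp', if_pos rfl, Finset.mul_sum, one_div p.toReal]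
    have hle : ∀ j, ρ (x j) (y j) ≤ ⨆ j, ρ (x j) (y j) :=
      fun j => le_ciSup (f := fun j => ρ (x j) (y j)) (Set.finite_range _).bddAbove j
    have hs : 0 ≤ ⨆ j, ρ (x j) (y j) := Real.iSup_nonneg hnn
    refine (Real.rpow_inv_le_iff_of_pos hsum hs ha0).2 ?_
    calc ∑ j, 1 / (k : ℝ) * ρ (x j) (y j) ^ p.toReal
        ≤ ∑ _j : Fin k, 1 / (k : ℝ) * (⨆ j, ρ (x j) (y j)) ^ p.toReal :=
          Finset.sum_le_sum fun j _ => mul_le_mul_of_nonneg_left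
            (Real.rpow_le_rpow (hnn j) (hle j) ha0.le) (by positivity)
      _ = _ := by rw [← Finset.sum_mul, hw, one_mul]
  · have hab : p.toReal ≤ q.toReal := ENNReal.toReal_mono hq' hpq
    have hb0 : 0 < q.toReal := by linarith
    rw [lpDist, lpDist, if_neg hp', if_neg hq', Finset.mul_sum, Finset.mul_sum]
    have h1 := Real.rpow_arith_mean_le_arith_mean_rpow Finset.univ (fun _ : Fin k => 1 / (k : ℝ))
      (fun j => ρ (x j) (y j) ^ p.toReal) (fun _ _ => by positivity) hw
      (fun j _ => Real.rpow_nonneg (hnn j) _) ((one_le_div ha0).2 hab)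
    have h2 := Real.rpow_le_rpow (Real.rpow_nonneg hsum _) h1 (by positivity : 0 ≤ 1 / q.toReal)
    rw [← Real.rpow_mul hsum, show q.toReal / p.toReal * (1 / q.toReal) = 1 / p.toReal by
      field_simp] at h2
    refine h2.trans_eq ?_
    congr 1
    refine Finset.sum_congr rfl fun j _ => ?_
    rw [← Real.rpow_mul (hnn j), mul_div_cancel₀ _ ha0.ne']

lemma lpDist_one {k : ℕ} (x y : Fin k → X) :
    lpDist ρ 1 x y = 1 / (k : ℝ) * ∑ j, ρ (x j) (y j) := by
  simp [lpDist]

lemma lpDist_two_lt_iff {k : ℕ} (x y : Fin k → X) {δ : ℝ} (hδ : 0 < δ) :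
    lpDist ρ 2 x y < δ ↔ 1 / (k : ℝ) * ∑ j, ρ (x j) (y j) ^ 2 < δ ^ 2 := by
  have h0 : 0 ≤ 1 / (k : ℝ) * ∑ j, ρ (x j) (y j) ^ 2 := by positivity
  have : lpDist ρ 2 x y = √(1 / (k : ℝ) * ∑ j, ρ (x j) (y j) ^ 2) := by
    simp [lpDist, Real.sqrt_eq_rpow]
  rw [this, Real.sqrt_lt h0 hδ.le]

lemma lpDist_top_lt {k : ℕ} {x y : Fin k → X} {ε : ℝ} (hε : 0 < ε)
    (h : ∀ j, ρ (x j) (y j) < ε) : lpDist ρ ∞ x y < ε := by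
  rw [lpDist, if_pos rfl]
  rcases isEmpty_or_nonempty (Fin k) with _ | _
  · simpa using hε
  · obtain ⟨j, hj⟩ := exists_eq_ciSup_of_finite (f := fun j => ρ (x j) (y j))
    rw [← hj]
    exact h j

lemma sum_lt_of_lpDist_one_lt {k : ℕ} (hk : 0 < k) {x y : Fin k → X} {η : ℝ}
    (h : lpDist ρ 1 x y < η) : ∑ j, ρ (x j) (y j) < k * η := by
  have hk' : (0 : ℝ) < k := by exact_mod_cast hk
  rw [lpDist_one, one_div, inv_mul_lt_iff₀ hk'] at h
  exact h

lemma denseCard_mono {Y : Type*} {d d' : Y → Y → ℝ} (h : ∀ x y, d x y ≤ d' x y) (ε : ℝ)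
    (A : Set Y) : denseCard ε A d ≤ denseCard ε A d' := by
  refine sInf_le_sInf ?_
  rintro n ⟨B, hB, hd, rfl⟩
  refine ⟨B, hB, fun a ha => ?_, rfl⟩
  obtain ⟨b, hb, hab⟩ := hd a ha
  exact ⟨b, hb, (h a b).trans_lt hab⟩

lemma exists_finset_of_denseCard_ne_top {Y : Type*} {d : Y → Y → ℝ} {ε : ℝ} {A : Set Y}
    (h : denseCard ε A d ≠ ⊤) :
    ∃ B : Finset Y, (B.card : ℕ∞) = denseCard ε A d ∧ ∀ a ∈ A, ∃ b ∈ B, d a b < ε := by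
  have hne : {n : ℕ∞ | ∃ B : Set Y, B ⊆ A ∧ (∀ a ∈ A, ∃ b ∈ B, d a b < ε) ∧
      n = B.encard}.Nonempty := by
    by_contra hcon
    rw [Set.not_nonempty_iff_eq_empty] at hcon
    exact h (by rw [denseCard, hcon, sInf_empty])
  obtain ⟨B, -, hd, hB⟩ := csInf_mem hne
  change denseCard ε A d = _ at hB
  have hfin : B.Finite := Set.encard_ne_top_iff.1 (hB ▸ h)
  refine ⟨hfin.toFinset, ?_, fun a ha => ?_⟩
  · rw [hB, hfin.encard_eq_coe_toFinset_card]
  · obtain ⟨b, hb, hab⟩ := hd a ha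
    exact ⟨b, hfin.mem_toFinset.2 hb, hab⟩

end LpDist

/-! ### Monotonicity in the exponent -/

section Monotonicity

variable {Γ X : Type*} [Group Γ] [MulAction Γ X]

lemma metricMdimAt_mono (S : SoficApproximation Γ) {p q : ℝ≥0∞} (hp : 1 ≤ p) (hpq : p ≤ q)
    (F : Finset Γ) (δ : ℝ) {ε : ℝ} (hε : 0 < ε) (hε1 : ε < 1) (ρ : PseudoMetric X ℝ) :
    metricMdimAt S p F δ ε ρ ≤ metricMdimAt S q F δ ε ρ := by
  refine limsup_le_limsup (Eventually.of_forall fun i => ?_)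
  refine EReal.div_le_div_right_of_nonneg ?_ (ENNReal.log_monotone (ENat.toENNReal_le.2
    (denseCard_mono (fun x y => lpDist_le_lpDist ρ hp hpq x y) _ _)))
  exact_mod_cast mul_nonneg (Nat.cast_nonneg _)
    (Real.log_nonneg ((one_le_div hε).2 hε1.le))

lemma metricMdimOf_mono (S : SoficApproximation Γ) {p q : ℝ≥0∞} (hp : 1 ≤ p) (hpq : p ≤ q)
    (ρ : PseudoMetric X ℝ) : metricMdimOf S p ρ ≤ metricMdimOf S q ρ := by
  refine liminf_le_liminf ?_
  filter_upwards [Ioo_mem_nhdsGT (zero_lt_one' ℝ)] with ε hε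
  exact iInf_mono fun F => iInf₂_mono fun δ _ => metricMdimAt_mono S hp hpq F δ hε.1 hε.2 ρ

lemma metricMdim_mono [TopologicalSpace X] (S : SoficApproximation Γ) {p q : ℝ≥0∞}
    (hp : 1 ≤ p) (hpq : p ≤ q) : metricMdim X S p ≤ metricMdim X S q :=
  iInf_mono fun ρ => iInf₂_mono fun _ _ => metricMdimOf_mono S hp hpq ρ

end Monotonicity

/-! ### Finite parts of a dynamically generating pseudometric -/

section Generating

variable {Γ X : Type*} [Group Γ] [MulAction Γ X]

/-- The pseudometric `∑_{g ∈ E} ρ(g x, g y)`. -/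
def orbitSum (ρ : PseudoMetric X ℝ) (E : Finset Γ) (x y : X) : ℝ :=
  ∑ g ∈ E, ρ (g • x) (g • y)

lemma orbitSum_nonneg (ρ : PseudoMetric X ℝ) (E : Finset Γ) (x y : X) : 0 ≤ orbitSum ρ E x y :=
  Finset.sum_nonneg fun _ _ => ρ.nonneg _ _

lemma orbitSum_self (ρ : PseudoMetric X ℝ) (E : Finset Γ) (x : X) : orbitSum ρ E x x = 0 := by
  simp [orbitSum]

lemma orbitSum_comm (ρ : PseudoMetric X ℝ) (E : Finset Γ) (x y : X) :
    orbitSum ρ E x y = orbitSum ρ E y x :=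
  Finset.sum_congr rfl fun _ _ => ρ.symm _ _

lemma orbitSum_triangle (ρ : PseudoMetric X ℝ) (E : Finset Γ) (x y z : X) :
    orbitSum ρ E x z ≤ orbitSum ρ E x y + orbitSum ρ E y z := by
  rw [orbitSum, orbitSum, orbitSum, ← Finset.sum_add_distrib]
  exact Finset.sum_le_sum fun _ _ => ρ.triangle _ _ _

variable [TopologicalSpace X]

lemma IsCompatibleMetric.isContinuousPseudometric {ρ : PseudoMetric X ℝ}
    (h : IsCompatibleMetric ρ) : IsContinuousPseudometric ρ := by
  have hball : ∀ x : X, ∀ ε : ℝ, 0 < ε → {y | ρ x y < ε} ∈ 𝓝 x := by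
    intro x ε hε
    refine IsOpen.mem_nhds ((h.2 _).2 fun y hy => ?_) (by simpa using hε)
    refine ⟨ε - ρ x y, sub_pos.2 hy, fun z hz => ?_⟩
    have := ρ.triangle x y z
    simp only [Set.mem_ofPred_eq]
    linarith
  refine continuous_iff_continuousAt.2 fun z => Metric.tendsto_nhds.2 fun ε hε => ?_
  filter_upwards [prod_mem_nhds (hball z.1 (ε / 2) (half_pos hε))
    (hball z.2 (ε / 2) (half_pos hε))] with w hw
  obtain ⟨h1, h2⟩ := hw
  simp only [Set.mem_ofPred_eq] at h1 h2
  have h3 := ρ.triangle w.1 z.1 w.2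
  have h4 := ρ.triangle z.1 z.2 w.2
  have h5 := ρ.triangle z.1 w.1 z.2
  have h6 := ρ.triangle w.1 w.2 z.2
  rw [ρ.symm w.1 z.1] at h3
  rw [ρ.symm w.2 z.2] at h6
  rw [Real.dist_eq, abs_lt]
  constructor <;> linarith

variable [ContinuousConstSMul Γ X]

lemma continuous_orbitSum {ρ : PseudoMetric X ℝ} (hρ : IsContinuousPseudometric ρ)
    (E : Finset Γ) : Continuous fun z : X × X => orbitSum ρ E z.1 z.2 := by
  refine continuous_finsetSum _ fun g _ => ?_
  exact hρ.comp ((continuous_fst.const_smul g).prodMk (continuous_snd.const_smul g))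

variable [CompactSpace X]

/-- The compact set `ρ' ≥ ε` misses the diagonal, so finitely many translates of `ρ` detect all its
points; `τ` is the minimum of their sum there. -/
lemma exists_orbitSum_lt {ρ ρ' : PseudoMetric X ℝ} (hρ : IsContinuousPseudometric ρ)
    (hgen : IsDynamicallyGenerating Γ ρ) (hρ' : IsContinuousPseudometric ρ') {ε : ℝ}
    (hε : 0 < ε) :
    ∃ (E : Finset Γ) (τ : ℝ), 0 < τ ∧ ∀ x y : X, orbitSum ρ E x y < τ → ρ' x y < ε := by
  have hK : IsCompact {z : X × X | ε ≤ ρ' z.1 z.2} := (isClosed_le continuous_const hρ').isCompact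
  obtain ⟨E, hE⟩ := hK.elim_finite_subcover
    (fun g : Γ => {z : X × X | 0 < ρ (g • z.1) (g • z.2)})
    (fun g => isOpen_lt continuous_const
      (hρ.comp ((continuous_fst.const_smul g).prodMk (continuous_snd.const_smul g))))
    (fun z hz => by
      obtain ⟨g, hg⟩ := hgen z.1 z.2 fun h => by
        have hz' : ε ≤ ρ' z.1 z.2 := hz
        rw [h, ρ'.refl] at hz'
        linarith
      exact Set.mem_iUnion.2 ⟨g, hg⟩)
  have hpos : ∀ z ∈ {z : X × X | ε ≤ ρ' z.1 z.2}, 0 < orbitSum ρ E z.1 z.2 := by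
    intro z hz
    obtain ⟨g, hg, hz'⟩ := Set.mem_iUnion₂.1 (hE hz)
    exact Finset.sum_pos' (fun _ _ => ρ.nonneg _ _) ⟨g, hg, hz'⟩
  rcases Set.eq_empty_or_nonempty {z : X × X | ε ≤ ρ' z.1 z.2} with h0 | hne
  · refine ⟨E, 1, one_pos, fun x y _ => ?_⟩
    by_contra h
    exact (Set.eq_empty_iff_forall_notMem.1 h0 (x, y)) (not_lt.1 h)
  · obtain ⟨z, hz, hmin⟩ := hK.exists_isMinOn hne (continuous_orbitSum hρ E).continuousOn
    refine ⟨E, _, hpos z hz, fun x y hxy => ?_⟩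
    by_contra h
    exact absurd (hmin (show (x, y) ∈ _ from not_lt.1 h)) (not_le.2 hxy)

lemma abs_clamp_sub_clamp_le (a b : ℝ) :
    |max 0 (min 1 a) - max 0 (min 1 b)| ≤ |a - b| := by
  have h1 := abs_max_sub_max_le_abs (min 1 a) (min 1 b) 0
  have h2 := abs_min_sub_min_le_max 1 a 1 b
  rw [max_comm 0, max_comm 0]
  refine (h1.trans h2).trans ?_
  simp

/-- Finitely many bump functions, Lipschitz for a finite part of `ρ`, that separate points at
`ρ'`-distance at least `ε`. -/
lemma exists_bump_functions {ρ ρ' : PseudoMetric X ℝ} (hρ : IsContinuousPseudometric ρ)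
    (hgen : IsDynamicallyGenerating Γ ρ) (hρ' : IsContinuousPseudometric ρ') {ε : ℝ}
    (hε : 0 < ε) :
    ∃ (E : Finset Γ) (L : ℝ) (n : ℕ) (f : Fin n → X → ℝ), 0 < L ∧ (∀ a, Continuous (f a)) ∧
      (∀ a x y, |f a x - f a y| ≤ L * orbitSum ρ E x y) ∧
      ∀ x y, (∀ a, f a x = 1 → 0 < f a y) → ρ' x y < ε := by
  obtain ⟨E, τ, hτ, hsep⟩ := exists_orbitSum_lt hρ hgen hρ' hε
  have hcont : ∀ x, Continuous fun y => orbitSum ρ E x y := fun x =>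
    (continuous_orbitSum hρ E).comp (continuous_const.prodMk continuous_id)
  obtain ⟨t, ht⟩ := isCompact_univ.elim_finite_subcover
    (fun x : X => {y | orbitSum ρ E x y < τ / 4})
    (fun x => isOpen_lt (hcont x) continuous_const)
    (fun x _ => Set.mem_iUnion.2 ⟨x, by simpa [orbitSum_self] using hτ⟩)
  let c : Fin t.card → X := fun a => (t.equivFin.symm a : X)
  -- Each bump is 1 within `τ / 4` of its centre and 0 from `τ / 2` on; the balls of radius `τ / 4`
  -- cover `X`.
  refine ⟨E, 4 / τ, t.card, fun a x => max 0 (min 1 (2 - 4 / τ * orbitSum ρ E (c a) x)),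
    by positivity, fun a => ?_, fun a x y => ?_, fun x y h => hsep x y ?_⟩
  · exact continuous_const.max (continuous_const.min
      (continuous_const.sub (continuous_const.mul (hcont _))))
  · refine (abs_clamp_sub_clamp_le _ _).trans ?_
    rw [show 2 - 4 / τ * orbitSum ρ E (c a) x - (2 - 4 / τ * orbitSum ρ E (c a) y) =
      4 / τ * (orbitSum ρ E (c a) y - orbitSum ρ E (c a) x) by ring, abs_mul,
      abs_of_pos (show 0 < 4 / τ by positivity)]
    refine mul_le_mul_of_nonneg_left ?_ (by positivity)
    have h1 := orbitSum_triangle ρ E (c a) x y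
    have h2 := orbitSum_triangle ρ E (c a) y x
    rw [orbitSum_comm ρ E y x] at h2
    rw [abs_le]
    constructor <;> linarith
  · obtain ⟨z, hz, hzx⟩ := Set.mem_iUnion₂.1 (ht (Set.mem_univ x))
    have hzx' : orbitSum ρ E z x < τ / 4 := hzx
    have hc : c (t.equivFin ⟨z, hz⟩) = z := by simp [c]
    have h1 := h (t.equivFin ⟨z, hz⟩)
    simp only [hc] at h1
    have h2 : 4 / τ * orbitSum ρ E z x ≤ 1 := by
      rw [div_mul_eq_mul_div, div_le_one hτ]
      linarith
    have h3 := h1 (by rw [min_eq_left (by linarith)]; simp)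
    have h4 : 4 / τ * orbitSum ρ E z y < 2 := by
      by_contra hcon
      have h5 : min 1 (2 - 4 / τ * orbitSum ρ E z y) ≤ 0 :=
        (min_le_right _ _).trans (by linarith)
      rw [max_eq_left h5] at h3
      exact lt_irrefl _ h3
    rw [div_mul_eq_mul_div, div_lt_iff₀ hτ] at h4
    have h6 := orbitSum_triangle ρ E x z y
    rw [orbitSum_comm ρ E x z] at h6
    linarith

end Generating

/-! ### Widths of sets of microstates -/

section Width

/-- Needed when there are no microstates, where the real bound to be proved may be negative. -/
lemma wdim_of_isEmpty {Y : Type*} [TopologicalSpace Y] [IsEmpty Y] (d : Y → Y → ℝ) (ε : ℝ) :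
    wdim Y d ε = ⊥ := by
  refine le_bot_iff.1 (sInf_le_of_le ⟨Empty, inferInstance, inferInstance, inferInstance,
    ⟨isEmptyElim, continuous_of_const fun x => isEmptyElim x, fun x => isEmptyElim x⟩, rfl⟩ ?_)
  refine sSup_le ?_
  rintro _ ⟨𝒰, h𝒰, rfl⟩
  exact sInf_le_of_le ⟨𝒰, h𝒰, fun V hV => ⟨V, hV, subset_rfl⟩, rfl⟩ (by simp [coverOrd])

/-- With `x = M * c b e`, these are the shifts `l` for which a value within 1 of `x` can fall in the
window `(l, l + 1)`. -/
lemma card_near_le_three {M : ℕ} (x : ℝ) :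
    (Finset.univ.filter fun l : Fin M => x - 2 < ((l : ℕ) : ℝ) ∧ ((l : ℕ) : ℝ) < x + 1).card ≤ 3 := by
  have h : (Finset.univ.filter fun l : Fin M =>
      x - 2 < ((l : ℕ) : ℝ) ∧ ((l : ℕ) : ℝ) < x + 1).card ≤
      (Finset.Icc (⌊x⌋ - 1) (⌊x⌋ + 1)).card := by
    refine Finset.card_le_card_of_injOn (fun l => ((l : ℕ) : ℤ)) (fun l hl => ?_) fun l _ l' _ h => ?_
    · obtain ⟨-, h1, h2⟩ := Finset.mem_filter.1 hl
      have h3 := Int.floor_le x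
      have h4 := Int.lt_floor_add_one x
      have h5 : ((⌊x⌋ - 2 : ℤ) : ℝ) < ((l : ℕ) : ℤ) := by push_cast; linarith
      have h6 : (((l : ℕ) : ℤ) : ℝ) < ((⌊x⌋ + 2 : ℤ) : ℝ) := by push_cast; linarith
      rw [Int.cast_lt] at h5 h6
      simp only [Finset.coe_Icc, Set.mem_Icc]
      constructor <;> omega
    · exact Fin.ext (Int.ofNat_inj.1 h)
  refine h.trans ?_
  rw [Int.card_Icc]
  omega

/-- A coordinate of the clamped map lies outside `{0, 1}` only if the shift is bad for the net point
(at most `k` coordinates) or the enlarged error is at least 1 (at most `M * W ≤ w` coordinates). -/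
lemma wdim_le_of_separating {X β : Type*} [TopologicalSpace X] (ρ' : PseudoMetric X ℝ) {ε : ℝ}
    (hε : 0 < ε) {d n M k w : ℕ} (hM : 0 < M) (f : Fin n → X → ℝ) (hf : ∀ a, Continuous (f a))
    (hsep : ∀ x y, (∀ a, f a x = 1 → 0 < f a y) → ρ' x y < ε) (Y : Set (Fin d → X))
    (B : Finset β) (hB : B.card * 6 ^ (d * n) < M ^ k) (c : β → Fin d × Fin n → ℝ) {W : ℝ}
    (hY : ∀ φ ∈ Y, ∃ b ∈ B, ∑ e : Fin d × Fin n, |f e.2 (φ e.1) - c b e| ≤ W)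
    (hW : M * W ≤ w) :
    wdim Y (fun φ ψ => lpDist ρ' ∞ φ.1 ψ.1) ε ≤ (((k + w : ℕ) : ℝ) : EReal) := by
  classical
  have hM' : (0 : ℝ) < M := by exact_mod_cast hM
  obtain ⟨ξ, hξ⟩ := exists_avoiding hM B
    (fun b (e : Fin d × Fin n) => Finset.univ.filter fun l : Fin M =>
      M * c b e - 2 < ((l : ℕ) : ℝ) ∧ ((l : ℕ) : ℝ) < M * c b e + 1)
    (fun b e => card_near_le_three _) (by simpa using hB)
  let G : (Fin d → X) → Fin d × Fin n → ℝ := fun φ e =>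
    max 0 (min 1 (M * f e.2 (φ e.1) - ((ξ e : ℕ) : ℝ)))
  have hGc : Continuous G := continuous_pi fun e => continuous_const.max (continuous_const.min
    ((continuous_const.mul ((hf e.2).comp (continuous_apply e.1))).sub continuous_const))
  have hG : ∀ φ ∈ Y, G φ ∈ cubeSkeleton (Fin d × Fin n) (k + w) := by
    intro φ hφ
    obtain ⟨b, hb, hsum⟩ := hY φ hφ
    obtain ⟨T, hT, hTξ⟩ := hξ b hb
    set T' := Finset.univ.filter fun e : Fin d × Fin n =>
      1 ≤ M * |f e.2 (φ e.1) - c b e| with hT'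
    have hcard : T'.card ≤ w := by
      have h1 : (T'.card : ℝ) ≤ w := by
        calc (T'.card : ℝ) = ∑ e ∈ T', (1 : ℝ) := by simp
          _ ≤ ∑ e ∈ T', M * |f e.2 (φ e.1) - c b e| :=
            Finset.sum_le_sum fun e he => (Finset.mem_filter.1 he).2
          _ ≤ ∑ e, M * |f e.2 (φ e.1) - c b e| :=
            Finset.sum_le_sum_of_subset_of_nonneg (Finset.subset_univ _)
              fun e _ _ => by positivity
          _ = M * ∑ e, |f e.2 (φ e.1) - c b e| := (Finset.mul_sum _ _ _).symm
          _ ≤ M * W := mul_le_mul_of_nonneg_left hsum hM'.le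
          _ ≤ w := hW
      exact_mod_cast h1
    refine ⟨fun e => ⟨le_max_left _ _, max_le zero_le_one (min_le_left _ _)⟩, T ∪ T',
      (Finset.card_union_le _ _).trans (add_le_add hT hcard), fun e he => ?_⟩
    rw [Finset.mem_union, not_or] at he
    have h1 := hTξ e he.1
    have h2 : M * |f e.2 (φ e.1) - c b e| < 1 := by
      by_contra hcon
      exact he.2 (Finset.mem_filter.2 ⟨Finset.mem_univ _, not_lt.1 hcon⟩)
    rw [← abs_of_pos hM', ← abs_mul, mul_sub, abs_lt] at h2
    by_cases h3 : M * f e.2 (φ e.1) - ((ξ e : ℕ) : ℝ) ≤ 0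
    · left
      exact max_eq_left ((min_le_right _ _).trans h3)
    · by_cases h4 : 1 ≤ M * f e.2 (φ e.1) - ((ξ e : ℕ) : ℝ)
      · right
        simp only [G, min_eq_left h4]
        exact max_eq_right zero_le_one
      · refine absurd (Finset.mem_filter.2 ⟨Finset.mem_univ _, ?_, ?_⟩) h1 <;> linarith
  refine sInf_le_of_le ⟨cubeSkeleton (Fin d × Fin n) (k + w), inferInstance,
    isCompact_iff_compactSpace.1 (isCompact_cubeSkeleton _ _), inferInstance,
    ⟨fun φ => ⟨G φ.1, hG φ.1 φ.2⟩, (hGc.comp continuous_subtype_val).subtype_mk _,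
      fun φ ψ h => lpDist_top_lt ρ' hε fun j => hsep _ _ fun a ha => ?_⟩, rfl⟩
    (coveringDim_cubeSkeleton_le _ _)
  have h1 : G φ.1 (j, a) = G ψ.1 (j, a) := congrFun (congrArg Subtype.val h) (j, a)
  -- As `0 ≤ ξ ≤ M - 1`, the value 1 of a bump is clamped to 1 and values at most 0 are clamped to
  -- 0.
  have hξM : ((ξ (j, a) : ℕ) : ℝ) + 1 ≤ M := by exact_mod_cast (ξ (j, a)).2
  simp only [G, ha, mul_one] at h1
  rw [min_eq_left (show (1 : ℝ) ≤ M - ((ξ (j, a) : ℕ) : ℝ) by linarith),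
    max_eq_right zero_le_one] at h1
  by_contra hcon
  have h2 : (M : ℝ) * f a (ψ.1 j) ≤ 0 := mul_nonpos_of_nonneg_of_nonpos hM'.le (not_lt.1 hcon)
  have h3 : (0 : ℝ) ≤ ((ξ (j, a) : ℕ) : ℝ) := Nat.cast_nonneg _
  rw [max_eq_left ((min_le_right _ _).trans (by linarith))] at h1
  exact one_ne_zero h1

variable {Γ X : Type*} [Group Γ] [MulAction Γ X]

lemma microstates_mono (ρ : PseudoMetric X ℝ) {F F' : Finset Γ} {δ δ' : ℝ} (hF : F' ⊆ F)
    (hδ : δ ≤ δ') {k : ℕ} (σ : Γ → Equiv.Perm (Fin k)) :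
    microstates ρ F δ σ ⊆ microstates ρ F' δ' σ :=
  fun _ hφ g hg => (hφ g (hF hg)).trans_le hδ

lemma sum_lt_of_mem_microstates {ρ : PseudoMetric X ℝ} {F : Finset Γ} {δ : ℝ} {k : ℕ}
    (hk : 0 < k) {σ : Γ → Equiv.Perm (Fin k)} {φ : Fin k → X} (hφ : φ ∈ microstates ρ F δ σ)
    {g : Γ} (hg : g ∈ F) : ∑ j, ρ (φ (σ g j)) (g • φ j) < k * δ :=
  sum_lt_of_lpDist_one_lt ρ hk
    ((lpDist_le_lpDist ρ le_rfl (by norm_num) _ _).trans_lt (hφ g hg))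

/-- On average `g • φ j` is close to `φ (σ g j)`, and reindexing by the permutation `σ g` does not
change the sum of distances; the errors are `η + 2η + η`. -/
lemma sum_orbitSum_le {ρ : PseudoMetric X ℝ} {E : Finset Γ} {η : ℝ} {k : ℕ} (hk : 0 < k)
    {σ : Γ → Equiv.Perm (Fin k)} {φ ψ : Fin k → X} (hφ : φ ∈ microstates ρ E η σ)
    (hψ : ψ ∈ microstates ρ E η σ) (h : ∑ j, ρ (φ j) (ψ j) ≤ 2 * (k * η)) :
    ∑ j, orbitSum ρ E (φ j) (ψ j) ≤ E.card * (4 * (k * η)) := by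
  have hone : ∀ g ∈ E, ∑ j, ρ (g • φ j) (g • ψ j) ≤ 4 * (k * η) := by
    intro g hg
    have h1 := sum_lt_of_mem_microstates hk hφ hg
    have h2 := sum_lt_of_mem_microstates hk hψ hg
    have h3 : ∑ j, ρ (φ (σ g j)) (ψ (σ g j)) ≤ 2 * (k * η) := by
      rwa [Equiv.sum_comp (σ g) fun j => ρ (φ j) (ψ j)]
    have h4 : ∑ j, ρ (g • φ j) (g • ψ j) ≤ ∑ j, (ρ (φ (σ g j)) (g • φ j) +
        ρ (φ (σ g j)) (ψ (σ g j)) + ρ (ψ (σ g j)) (g • ψ j)) := by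
      refine Finset.sum_le_sum fun j _ => ?_
      have h5 := ρ.triangle (g • φ j) (φ (σ g j)) (g • ψ j)
      have h6 := ρ.triangle (φ (σ g j)) (ψ (σ g j)) (g • ψ j)
      rw [ρ.symm (g • φ j) (φ (σ g j))] at h5
      linarith
    rw [Finset.sum_add_distrib, Finset.sum_add_distrib] at h4
    linarith
  simp only [orbitSum]
  rw [Finset.sum_comm]
  refine (Finset.sum_le_sum hone).trans_eq ?_
  simp

lemma wdim_le_of_finite_net [TopologicalSpace X] {ρ ρ' : PseudoMetric X ℝ} {ε : ℝ} (hε : 0 < ε)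
    {E : Finset Γ} {L : ℝ} (hL : 0 < L) {n : ℕ} {f : Fin n → X → ℝ}
    (hf : ∀ a, Continuous (f a)) (hlip : ∀ a x y, |f a x - f a y| ≤ L * orbitSum ρ E x y)
    (hsep : ∀ x y, (∀ a, f a x = 1 → 0 < f a y) → ρ' x y < ε)
    {c θ κ η : ℝ} (hc : 0 ≤ c) (hθ : 0 < θ) (hκ : κ = θ / (n * L * E.card * 4 + 1))
    (hη : 0 < η) (hηκ : η ≤ κ)
    (hlog : n * Real.log 6 < θ * Real.log (1 / η) + (c + θ) * Real.log (κ / 2))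
    {d : ℕ} (hd : 1 ≤ θ * d) {σ : Γ → Equiv.Perm (Fin d)} {Y : Set (Fin d → X)}
    (hY : Y ⊆ microstates ρ E η σ) {B : Finset (Fin d → X)}
    (hB : ∀ φ ∈ Y, ∃ b ∈ B, lpDist ρ 1 φ b < η)
    (hcard : (B.card : ℝ) ≤ Real.exp (c * (d * Real.log (1 / η)))) :
    wdim Y (fun φ ψ => lpDist ρ' ∞ φ.1 ψ.1) ε ≤ (((c + 4 * θ) * d : ℝ) : EReal) := by
  have hd0 : 0 < d := by
    rcases Nat.eq_zero_or_pos d with rfl | h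
    · norm_num at hd
    · exact h
  have hd' : (0 : ℝ) < d := by exact_mod_cast hd0
  set C : ℝ := n * L * E.card * 4 with hC
  have hC0 : 0 ≤ C := by positivity
  have hκ0 : 0 < κ := by rw [hκ]; positivity
  have hκC : κ * C ≤ θ := by
    rw [hκ, div_mul_eq_mul_div, div_le_iff₀ (by linarith)]
    nlinarith
  -- A net point need not be a microstate for `E` and `η`, so its orbit is not controlled. It is
  -- replaced by a point of `Y` near it, which doubles the distance.
  have hnet : ∀ b : Fin d → X, ∃ y : Fin d × Fin n → ℝ, ∀ φ ∈ Y, lpDist ρ 1 φ b < η →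
      ∑ e : Fin d × Fin n, |f e.2 (φ e.1) - y e| ≤ C * (d * η) := by
    intro b
    by_cases h : ∃ ψ ∈ Y, lpDist ρ 1 ψ b < η
    · obtain ⟨ψ, hψ, hψb⟩ := h
      refine ⟨fun e => f e.2 (ψ e.1), fun φ hφ hφb => ?_⟩
      have h1 := sum_lt_of_lpDist_one_lt ρ hd0 hφb
      have h2 := sum_lt_of_lpDist_one_lt ρ hd0 hψb
      have h3 : ∑ j, ρ (φ j) (ψ j) ≤ ∑ j, (ρ (φ j) (b j) + ρ (ψ j) (b j)) :=
        Finset.sum_le_sum fun j _ => by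
          rw [ρ.symm (ψ j) (b j)]
          exact ρ.triangle _ _ _
      rw [Finset.sum_add_distrib] at h3
      have h4 := sum_orbitSum_le hd0 (hY hφ) (hY hψ) (by linarith)
      calc ∑ e : Fin d × Fin n, |f e.2 (φ e.1) - f e.2 (ψ e.1)|
          ≤ ∑ e : Fin d × Fin n, L * orbitSum ρ E (φ e.1) (ψ e.1) :=
            Finset.sum_le_sum fun e _ => hlip _ _ _
        _ = n * L * ∑ j, orbitSum ρ E (φ j) (ψ j) := by
            rw [Fintype.sum_prod_type]
            simp only [Finset.sum_const, Finset.card_univ, Fintype.card_fin, nsmul_eq_mul]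
            rw [Finset.mul_sum]
            exact Finset.sum_congr rfl fun j _ => by ring
        _ ≤ n * L * (E.card * (4 * (d * η))) := mul_le_mul_of_nonneg_left h4 (by positivity)
        _ = C * (d * η) := by rw [hC]; ring
    · exact ⟨0, fun φ hφ hφb => absurd ⟨φ, hφ, hφb⟩ h⟩
  choose y hy using hnet
  have hM1 : 1 ≤ ⌊κ / η⌋₊ := Nat.le_floor (by simpa using (one_le_div hη).2 hηκ)
  set M := ⌊κ / η⌋₊ with hMdef
  have hM1' : (1 : ℝ) ≤ M := by exact_mod_cast hM1
  have hMle : (M : ℝ) ≤ κ / η := Nat.floor_le (by positivity)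
  have hMge : κ / 2 * (1 / η) ≤ M := by
    have h1 : κ / η < M + 1 := Nat.lt_floor_add_one _
    have h2 : κ / 2 * (1 / η) = κ / η / 2 := by ring
    linarith
  have hlogM : Real.log (κ / 2) + Real.log (1 / η) ≤ Real.log M := by
    rw [← Real.log_mul (by positivity) (by positivity)]
    exact Real.log_le_log (by positivity) hMge
  have hlogM0 : 0 ≤ Real.log M := Real.log_nonneg hM1'
  set k := ⌈(c + θ) * d⌉₊ with hk
  set w := ⌈θ * d⌉₊ with hw
  have hk1 : (c + θ) * d ≤ k := Nat.le_ceil _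
  have hk2 : (k : ℝ) < (c + θ) * d + 1 := Nat.ceil_lt_add_one (by positivity)
  have hw1 : θ * d ≤ w := Nat.le_ceil _
  have hw2 : (w : ℝ) < θ * d + 1 := Nat.ceil_lt_add_one (by positivity)
  have hBM : B.card * 6 ^ (d * n) < M ^ k := by
    have h1 : c * (d * Real.log (1 / η)) + d * n * Real.log 6 < k * Real.log M := by
      have h2 : (c + θ) * d * (Real.log (κ / 2) + Real.log (1 / η)) ≤ k * Real.log M :=
        (mul_le_mul_of_nonneg_left hlogM (by positivity)).trans
          (mul_le_mul_of_nonneg_right hk1 hlogM0)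
      have h3 := mul_lt_mul_of_pos_left hlog hd'
      refine lt_of_lt_of_le ?_ h2
      linarith
    have h2 : (B.card : ℝ) * 6 ^ (d * n) < M ^ k := by
      calc (B.card : ℝ) * 6 ^ (d * n)
          ≤ Real.exp (c * (d * Real.log (1 / η))) * 6 ^ (d * n) :=
            mul_le_mul_of_nonneg_right hcard (by positivity)
        _ = Real.exp (c * (d * Real.log (1 / η)) + d * n * Real.log 6) := by
            rw [Real.exp_add, ← Nat.cast_mul, Real.exp_nat_mul, Real.exp_log (by norm_num)]
        _ < Real.exp (k * Real.log M) := Real.exp_lt_exp.2 h1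
        _ = M ^ k := by rw [Real.exp_nat_mul, Real.exp_log (by linarith)]
    exact_mod_cast h2
  refine (wdim_le_of_separating ρ' hε (w := w) hM1 f hf hsep Y B hBM y (W := C * (d * η))
    (fun φ hφ => ?_) ?_).trans (EReal.coe_le_coe_iff.2 ?_)
  · obtain ⟨b, hb, hφb⟩ := hB φ hφ
    exact ⟨b, hb, hy b φ hφ hφb⟩
  · calc M * (C * (d * η)) ≤ κ / η * (C * (d * η)) :=
          mul_le_mul_of_nonneg_right hMle (by positivity)
      _ = κ * C * d := by field_simp
      _ ≤ θ * d := mul_le_mul_of_nonneg_right hκC hd'.le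
      _ ≤ w := hw1
  -- The two ceilings cost at most `2 ≤ 2 * θ * d`.
  · push_cast
    linarith

end Width

/-! ### Comparison of mean dimension with metric mean dimension -/

section Comparison

variable {Γ X : Type*} [Group Γ]

lemma eventually_card_ne_le (S : SoficApproximation Γ) (g h : Γ) {γ : ℝ} (hγ : 0 < γ) :
    ∀ᶠ i in atTop, ((Finset.univ.filter
      fun k : Fin (S.d i) => S.σ i g (S.σ i h k) ≠ S.σ i (g * h) k).card : ℝ) ≤ γ * S.d i := by
  filter_upwards [(S.asymp_mul g h).eventually (lt_mem_nhds (show 1 - γ < 1 by linarith)),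
    S.tendsto_d.eventually_gt_atTop 0] with i hi hd
  have hd' : (0 : ℝ) < S.d i := by exact_mod_cast hd
  rw [lt_div_iff₀ hd'] at hi
  have h1 := Finset.card_filter_add_card_filter_not (s := Finset.univ)
    fun k : Fin (S.d i) => S.σ i g (S.σ i h k) = S.σ i (g * h) k
  rw [Finset.card_univ, Fintype.card_fin] at h1
  have h2 : ((Finset.univ.filter fun k : Fin (S.d i) =>
      S.σ i g (S.σ i h k) = S.σ i (g * h) k).card : ℝ) + ((Finset.univ.filter
      fun k : Fin (S.d i) => S.σ i g (S.σ i h k) ≠ S.σ i (g * h) k).card : ℝ) = S.d i := by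
    exact_mod_cast h1
  linarith

variable [MulAction Γ X] [TopologicalSpace X] [CompactSpace X]

omit [Group Γ] [MulAction Γ X] in
lemma IsContinuousPseudometric.exists_bound {ρ : PseudoMetric X ℝ}
    (hρ : IsContinuousPseudometric ρ) : ∃ R : ℝ, ∀ x y, ρ x y ≤ R := by
  obtain ⟨R, hR⟩ := isCompact_univ.exists_bound_of_continuousOn hρ.continuousOn
  exact ⟨R, fun x y => (le_abs_self _).trans (hR (x, y) (Set.mem_univ _))⟩

variable [ContinuousConstSMul Γ X]

/-- For `h ∈ E`, `g ∈ F'` and most `j`, `h • φ (σ g j) ≈ φ (σ h (σ g j)) = φ (σ (h * g) j) ≈ h • g •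
φ j`. So the orbit sum over `E` is small on average, and it controls `ρ'`. -/
lemma eventually_microstates_subset (S : SoficApproximation Γ) {ρ ρ' : PseudoMetric X ℝ}
    (hρ : IsContinuousPseudometric ρ) (hgen : IsDynamicallyGenerating Γ ρ)
    (hρ' : IsContinuousPseudometric ρ') (F' : Finset Γ) {δ' : ℝ} (hδ' : 0 < δ') :
    ∃ (F : Finset Γ) (δ : ℝ), 0 < δ ∧
      ∀ᶠ i in atTop, microstates ρ F δ (S.σ i) ⊆ microstates ρ' F' δ' (S.σ i) := by
  classical
  obtain ⟨R₁, hR₁⟩ := hρ.exists_bound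
  obtain ⟨R₂, hR₂⟩ := hρ'.exists_bound
  set R := max 1 (max R₁ R₂) with hR
  have hR0 : 0 < R := lt_of_lt_of_le one_pos (le_max_left _ _)
  have hρR : ∀ x y, ρ x y ≤ R := fun x y =>
    (hR₁ x y).trans ((le_max_left _ _).trans (le_max_right _ _))
  have hρR' : ∀ x y, ρ' x y ≤ R := fun x y =>
    (hR₂ x y).trans ((le_max_right _ _).trans (le_max_right _ _))
  obtain ⟨E, κ, hκ, hE⟩ := exists_orbitSum_lt hρ hgen hρ' (half_pos hδ')
  set e : ℝ := E.card + 1 with he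
  have he0 : 0 < e := by positivity
  -- Chosen so that `R ^ 2 / κ * (3 * e * v) = δ' ^ 2 / 2`, which with `(δ' / 2) ^ 2` stays below
  -- `δ' ^ 2`.
  set v : ℝ := δ' ^ 2 * κ / (6 * e * R ^ 2) with hv
  have hv0 : 0 < v := by positivity
  refine ⟨E ∪ (E ×ˢ F').image (fun z => z.1 * z.2), v, hv0, ?_⟩
  have hev : ∀ z ∈ E ×ˢ F', ∀ᶠ i in atTop, ((Finset.univ.filter fun k : Fin (S.d i) =>
      S.σ i z.1 (S.σ i z.2 k) ≠ S.σ i (z.1 * z.2) k).card : ℝ) ≤ v / R * S.d i :=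
    fun z _ => eventually_card_ne_le S z.1 z.2 (by positivity)
  filter_upwards [(Finset.eventually_all _).2 hev, S.tendsto_d.eventually_gt_atTop 0]
    with i hi hd φ hφ g hg
  have hd' : (0 : ℝ) < S.d i := by exact_mod_cast hd
  have hmain : ∀ h ∈ E, ∑ j, ρ (h • φ (S.σ i g j)) (h • g • φ j) ≤ 3 * v * S.d i := by
    intro h hh
    have h1 := sum_lt_of_mem_microstates hd hφ (Finset.mem_union_left _ hh)
    have h2 := sum_lt_of_mem_microstates hd hφ (Finset.mem_union_right _
      (Finset.mem_image_of_mem (fun z : Γ × Γ => z.1 * z.2) (Finset.mk_mem_product hh hg)))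
    simp only [mul_smul] at h2
    have h3 := hi (h, g) (Finset.mk_mem_product hh hg)
    rw [← Equiv.sum_comp (S.σ i g)] at h1
    have h4 : ∑ j, ρ (φ (S.σ i h (S.σ i g j))) (φ (S.σ i (h * g) j)) ≤ v * S.d i := by
      calc ∑ j, ρ (φ (S.σ i h (S.σ i g j))) (φ (S.σ i (h * g) j))
          ≤ ∑ j, if S.σ i h (S.σ i g j) ≠ S.σ i (h * g) j then R else 0 := by
            refine Finset.sum_le_sum fun j _ => ?_
            split_ifs with hj
            · exact hρR _ _
            · rw [not_not.1 hj, ρ.refl]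
        _ = (Finset.univ.filter fun k : Fin (S.d i) =>
            S.σ i h (S.σ i g k) ≠ S.σ i (h * g) k).card * R := by
            rw [← Finset.sum_filter, Finset.sum_const, nsmul_eq_mul]
        _ ≤ v / R * S.d i * R := mul_le_mul_of_nonneg_right h3 hR0.le
        _ = v * S.d i := by field_simp
    have h5 : ∑ j, ρ (h • φ (S.σ i g j)) (h • g • φ j) ≤
        ∑ j, (ρ (φ (S.σ i h (S.σ i g j))) (h • φ (S.σ i g j)) +
          ρ (φ (S.σ i h (S.σ i g j))) (φ (S.σ i (h * g) j)) +
          ρ (φ (S.σ i (h * g) j)) (h • g • φ j)) := by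
      refine Finset.sum_le_sum fun j _ => ?_
      have h6 := ρ.triangle (h • φ (S.σ i g j)) (φ (S.σ i h (S.σ i g j))) (h • g • φ j)
      have h7 := ρ.triangle (φ (S.σ i h (S.σ i g j))) (φ (S.σ i (h * g) j)) (h • g • φ j)
      rw [ρ.symm (h • φ (S.σ i g j)) (φ (S.σ i h (S.σ i g j)))] at h6
      linarith
    rw [Finset.sum_add_distrib, Finset.sum_add_distrib] at h5
    linarith
  have horbit : ∑ j, orbitSum ρ E (φ (S.σ i g j)) (g • φ j) ≤ e * (3 * v * S.d i) := by
    simp only [orbitSum]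
    rw [Finset.sum_comm]
    refine (Finset.sum_le_sum hmain).trans ?_
    rw [Finset.sum_const, nsmul_eq_mul]
    exact mul_le_mul_of_nonneg_right (by linarith) (by positivity)
  have hpt : ∀ x y, ρ' x y ^ 2 ≤ (δ' / 2) ^ 2 + R ^ 2 / κ * orbitSum ρ E x y := by
    intro x y
    have h0 := orbitSum_nonneg ρ E x y
    rcases lt_or_ge (orbitSum ρ E x y) κ with h | h
    · have h1 := pow_le_pow_left₀ (ρ'.nonneg x y) (hE x y h).le 2
      have h2 : 0 ≤ R ^ 2 / κ * orbitSum ρ E x y := by positivity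
      linarith
    · have h1 := pow_le_pow_left₀ (ρ'.nonneg x y) (hρR' x y) 2
      have h2 : R ^ 2 ≤ R ^ 2 / κ * orbitSum ρ E x y := by
        rw [div_mul_eq_mul_div, le_div_iff₀ hκ]
        exact mul_le_mul_of_nonneg_left h (by positivity)
      have h3 : 0 ≤ (δ' / 2) ^ 2 := by positivity
      linarith
  refine (lpDist_two_lt_iff ρ' _ _ hδ').2 ?_
  rw [one_div, inv_mul_lt_iff₀ hd']
  calc ∑ j, ρ' (φ (S.σ i g j)) (g • φ j) ^ 2
      ≤ ∑ j, ((δ' / 2) ^ 2 + R ^ 2 / κ * orbitSum ρ E (φ (S.σ i g j)) (g • φ j)) :=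
        Finset.sum_le_sum fun j _ => hpt _ _
    _ = S.d i * (δ' / 2) ^ 2 + R ^ 2 / κ * ∑ j, orbitSum ρ E (φ (S.σ i g j)) (g • φ j) := by
        rw [Finset.sum_add_distrib, ← Finset.mul_sum]
        simp
    _ ≤ S.d i * (δ' / 2) ^ 2 + R ^ 2 / κ * (e * (3 * v * S.d i)) := by gcongr
    _ = S.d i * (δ' ^ 2 * (3 / 4)) := by
        rw [hv]
        field_simp
        ring
    _ < S.d i * δ' ^ 2 := mul_lt_mul_of_pos_left (by nlinarith [pow_pos hδ' 2]) hd'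

lemma eventually_log_large {n : ℕ} {c θ κ : ℝ} (hθ : 0 < θ) :
    ∀ᶠ η in 𝓝[>] (0 : ℝ),
      n * Real.log 6 < θ * Real.log (1 / η) + (c + θ) * Real.log (κ / 2) := by
  have h : Tendsto (fun η : ℝ => Real.log (1 / η)) (𝓝[>] 0) atTop := by
    simp only [one_div]
    exact Real.tendsto_log_atTop.comp tendsto_inv_nhdsGT_zero
  filter_upwards [h.eventually_gt_atTop
    ((n * Real.log 6 - (c + θ) * Real.log (κ / 2)) / θ)] with η hη
  rw [div_lt_iff₀ hθ] at hη
  linarith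

lemma mdim_le_metricMdimOf (S : SoficApproximation Γ) {ρ ρ' ρ₁ : PseudoMetric X ℝ}
    (hρ : IsContinuousPseudometric ρ) (hgen : IsDynamicallyGenerating Γ ρ)
    (hρ' : IsContinuousPseudometric ρ') (hρ₁ : IsContinuousPseudometric ρ₁)
    (hgen₁ : IsDynamicallyGenerating Γ ρ₁) :
    mdim S ρ ρ' ≤ metricMdimOf S 1 ρ₁ := by
  classical
  refine EReal.le_of_forall_lt_iff_le.1 fun c' hc' => ?_
  obtain ⟨c, hc, hcc'⟩ := EReal.lt_iff_exists_real_btwn.1 hc'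
  rw [EReal.coe_lt_coe_iff] at hcc'
  obtain ⟨θ, hθ, rfl⟩ : ∃ θ : ℝ, 0 < θ ∧ c' = c + 4 * θ :=
    ⟨(c' - c) / 4, by linarith, by ring⟩
  refine iSup₂_le fun ε hε => ?_
  obtain ⟨E, L, n, f, hL, hf, hlip, hsep⟩ := exists_bump_functions hρ₁ hgen₁ hρ' hε
  obtain ⟨κ, hκ⟩ : ∃ κ : ℝ, κ = θ / (n * L * E.card * 4 + 1) := ⟨_, rfl⟩
  have hκ0 : 0 < κ := by rw [hκ]; positivity
  -- The lower limit provides only arbitrarily small good scales, but a single sufficiently small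
  -- `η` is enough for the given `ε`.
  have hfreq : ∃ᶠ η in 𝓝[>] (0 : ℝ), (⨅ (F : Finset Γ) (δ : ℝ) (_ : 0 < δ),
      metricMdimAt S 1 F δ η ρ₁) < (c : EReal) := frequently_lt_of_liminf_lt (by isBoundedDefault) hc
  obtain ⟨η, hlt, hη, hlog⟩ := (hfreq.and_eventually
    ((show ∀ᶠ η in 𝓝[>] (0 : ℝ), η ∈ Set.Ioo 0 (min 1 κ) from
      Ioo_mem_nhdsGT (lt_min one_pos hκ0)).and
      (eventually_log_large (n := n) (c := c) (κ := κ) hθ))).exists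
  have hη0 : 0 < η := hη.1
  have hη1 : η < 1 := hη.2.trans_le (min_le_left _ _)
  have hηκ : η ≤ κ := hη.2.le.trans (min_le_right _ _)
  simp only [iInf_lt_iff] at hlt
  obtain ⟨F, δ, hδ, hlt⟩ := hlt
  obtain ⟨F₀, δ₀, hδ₀, hsub⟩ :=
    eventually_microstates_subset S hρ hgen hρ₁ (F ∪ E) (lt_min hδ hη0)
  refine iInf_le_of_le F₀ (iInf₂_le_of_le δ₀ hδ₀ ?_)
  refine limsup_le_of_le (by isBoundedDefault) ?_
  filter_upwards [hsub, eventually_lt_of_limsup_lt hlt, S.tendsto_d.eventually_gt_atTop 0,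
    (tendsto_natCast_atTop_atTop.comp S.tendsto_d).eventually_ge_atTop (1 / θ)]
    with i hsub hS hd hdθ
  have hd' : (0 : ℝ) < S.d i := by exact_mod_cast hd
  have hdθ' : 1 ≤ θ * S.d i := by
    rw [Function.comp_apply, div_le_iff₀ hθ] at hdθ
    linarith
  have hlogη : 0 < Real.log (1 / η) := Real.log_pos ((one_lt_div hη0).2 hη1)
  rw [EReal.div_le_iff_le_mul (by exact_mod_cast hd') (EReal.coe_ne_top _)]
  rw [EReal.div_lt_iff (by exact_mod_cast mul_pos hd' hlogη) (EReal.coe_ne_top _),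
    ← EReal.coe_mul] at hS
  have hne : denseCard η (microstates ρ₁ F δ (S.σ i)) (lpDist ρ₁ 1) ≠ ⊤ := by
    intro h
    rw [h] at hS
    simp at hS
  obtain ⟨B, hBcard, hB⟩ := exists_finset_of_denseCard_ne_top hne
  have hsub₁ : microstates ρ F₀ δ₀ (S.σ i) ⊆ microstates ρ₁ F δ (S.σ i) :=
    hsub.trans (microstates_mono ρ₁ Finset.subset_union_left (min_le_left _ _) _)
  have hsub₂ : microstates ρ F₀ δ₀ (S.σ i) ⊆ microstates ρ₁ E η (S.σ i) :=
    hsub.trans (microstates_mono ρ₁ Finset.subset_union_right (min_le_right _ _) _)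
  rcases isEmpty_or_nonempty (microstates ρ F₀ δ₀ (S.σ i)) with _ | ⟨⟨φ, hφ⟩⟩
  · rw [wdim_of_isEmpty]
    exact bot_le
  have hBpos : 0 < B.card := by
    obtain ⟨b, hb, -⟩ := hB φ (hsub₁ hφ)
    exact Finset.card_pos.2 ⟨b, hb⟩
  have hBpos' : (1 : ℝ) ≤ B.card := by exact_mod_cast hBpos
  rw [← hBcard, ENat.toENNReal_coe, ← ENNReal.ofReal_natCast,
    ENNReal.log_ofReal_of_pos (by linarith), EReal.coe_lt_coe_iff] at hS
  -- A microstate exists, so the net is nonempty and its logarithm is nonnegative.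
  have hc0 : 0 ≤ c := by
    by_contra hneg
    have h1 := Real.log_nonneg hBpos'
    have h2 := mul_neg_of_neg_of_pos (not_le.1 hneg) (mul_pos hd' hlogη)
    linarith
  have hcard : (B.card : ℝ) ≤ Real.exp (c * (S.d i * Real.log (1 / η))) :=
    ((Real.log_lt_iff_lt_exp (by linarith)).1 hS).le
  refine (wdim_le_of_finite_net hε hL hf hlip hsep hc0 hθ hκ hη0 hηκ hlog hdθ' hsub₂
    (fun φ hφ => hB φ (hsub₁ hφ)) hcard).trans_eq ?_
  rw [← EReal.coe_mul, mul_comm]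

end Comparison

end SoficMeanDim

theorem corollary2p8 {Γ X : Type*} [Group Γ] [Countable Γ]
    [TopologicalSpace X] [CompactSpace X] [TopologicalSpace.MetrizableSpace X]
    [MulAction Γ X] [ContinuousConstSMul Γ X]
    (S : SoficMeanDim.SoficApproximation Γ) (p q : ENNReal) (hp : 1 ≤ p) (hpq : p ≤ q) :
    (∀ ρ ρ' : PseudoMetric X ℝ,
      SoficMeanDim.IsContinuousPseudometric ρ → SoficMeanDim.IsDynamicallyGenerating Γ ρ →
      SoficMeanDim.IsCompatibleMetric ρ' →
      SoficMeanDim.mdim S ρ ρ' ≤ SoficMeanDim.metricMdim X S p) ∧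
    SoficMeanDim.metricMdim X S p ≤ SoficMeanDim.metricMdim X S q := by
  refine ⟨fun ρ ρ' hρ hgen hρ' => ?_, SoficMeanDim.metricMdim_mono S hp hpq⟩
  refine le_iInf fun ρ₁ => le_iInf₂ fun hρ₁ hgen₁ => ?_
  exact (SoficMeanDim.mdim_le_metricMdimOf S hρ hgen hρ'.isContinuousPseudometric hρ₁ hgen₁).trans
    (SoficMeanDim.metricMdimOf_mono S le_rfl hp ρ₁)
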